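/- **Theorem.** Checking run-boundedness of data-centric dynamic systems (DCDSs) with deterministic services is undecidable: there is no algorithm that, given (a finite description of) a DCDS $\mathcal S$, decides whether $\mathcal S$ with deterministic services is run-bounded. Here the notions are as follows. Fix a countably infinite set $\mathcal C$ of constants (say $\mathcal C=\mathbb N$). *DCDS.* A DCDS $\mathcal S=\langle\mathcal D,\mathcal P\rangle$ consists of a data layer and a process layer. The data layer $\mathcal D=\langle\mathcal C,\mathcal R,\mathcal E,\mathcal I_0\rangle$ has a finite relational schema $\mathcal R$, a finite set $\mathcal E$ of equality constraints $Q\to\bigwedge_j z_j=y_j$ ($Q$ a domain-independent first-order query over $\mathcal R$; $z_j,y_j$ free variables of $Q$ or constants) and a finite initial instance $\mathcal I_0$ over $\mathcal R$ that satisfies $\mathcal E$. The process layer $\mathcal P=\langle\mathcal F,\mathcal A,\varrho\rangle$ has a finite set $\mathcal F$ of service symbols with arities, a finite set $\mathcal A$ of actions, and a finite set $\varrho$ of rules $Q\mapsto\alpha$ with $\alpha\in\mathcal A$ and $Q$ a first-order query whose free variables are exactly the parameters of $\alpha$. An action has a list of parameters and a finite set of effects $q^+\wedge Q^-\rightsquigarrow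 E$, where $q^+$ is a union of conjunctive queries, $Q^-$ is a first-order formula whose free variables are parameters or free variables of $q^+$, and $E$ is a finite set of atoms over $\mathcal R$ whose arguments are basic terms (constants, parameters, free variables of $q^+$) or service calls $f(t_1,\dots,t_n)$ with $f\in\mathcal F$ and basic terms $t_i$. All constants used occur in $\mathcal I_0$. Queries are evaluated under the active-domain semantics (over the constants of the instance and of the query); $\mathrm{ans}(Q,\mathcal I)$ is the set of answers, and $\mathrm{adom}(\mathcal I)$ the set of constants that occur in $\mathcal I$. *Concrete transition system.* A state is a pair $\langle\mathcal I,\mathcal M\rangle$ of an instance and a partial map $\mathcal M$ from service calls $f(v_1,\dots,v_n)$, $v_i\in\mathcal C$, to $\mathcal C$; the initial state is $\langle\mathcal I_0,\emptyset\rangle$. There is a transition $\langle\mathcal I,\mathcal M\rangle\Rightarrow\langle\mathcal I',\mathcal M'\rangle$ iff, for some rule $Q\mapsto\alpha$ and some $\sigma\in\mathrm{ans}(Q,\mathcal I)$, the following holds, with $G=\bigcup_{(q^+\wedge Q^-\rightsquigarrow E)\in\alpha}\ \bigcup_{\theta\in\mathrm{ans}((q^+\wedge Q^-)\sigma,\mathcal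 I)}E\sigma\theta$: $\mathcal M'$ extends $\mathcal M$, its domain is that of $\mathcal M$ together with the service calls occurring in $G$ (new calls receive arbitrary values in $\mathcal C$), $\mathcal I'$ results from $G$ by replacing each service call by its value under $\mathcal M'$, and $\mathcal I'$ satisfies $\mathcal E$. The states of the transition system are those reachable from the initial one. *Run-boundedness.* $\mathcal S$ is run-bounded if there is a number $b$ such that, for every finite or infinite run $s_0\Rightarrow s_1\Rightarrow\cdots$ from the initial state, with $s_i=\langle\mathcal I_i,\mathcal M_i\rangle$, $\bigl|\bigcup_i\mathrm{adom}(\mathcal I_i)\bigr|<b$. -/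

import Mathlib

namespace DataCentric

/-! ### First-order queries

The countably infinite set of constants is `ℕ`, and so is the set of variables.  Relation symbols
and service symbols are the positions in a list of arities. -/

/-- A term of a query: a variable or a constant. -/
inductive Term : Type
  | var (x : ℕ)
  | const (c : ℕ)

namespace Term

def eval (v : ℕ → ℕ) : Term → ℕ
  | var x => v x
  | const c => c

def vars : Term → Finset ℕ
  | var x => {x}
  | const _ => ∅

def consts : Term → Finset ℕ
  | var _ => ∅
  | const c => {c}

/-- Replace each variable `x ∈ P` by the constant `σ x`. -/
def subst (P : Finset ℕ) (σ : ℕ → ℕ) : Term → Term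
  | var x => if x ∈ P then const (σ x) else var x
  | const c => const c

end Term

/-- A fact `R(c₁,…,cₙ)`: a relation symbol with a list of constants. -/
abbrev Fact : Type := ℕ × List ℕ

/-- A relational instance: a set of facts. -/
abbrev Instance : Type := Set Fact

/-- The active domain: all constants that occur in the instance. -/
def adom (I : Instance) : Set ℕ := {c | ∃ F ∈ I, c ∈ F.2}

/-- `I` conforms to the schema with the given list of arities. -/
def Conforms (schema : List ℕ) (I : Instance) : Prop :=
  ∀ F ∈ I, schema[F.1]? = some F.2.length

/-- First-order formulas over a relational vocabulary, with equality. -/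
inductive Formula : Type
  | tru
  | atom (R : ℕ) (ts : List Term)
  | eq (s t : Term)
  | neg (φ : Formula)
  | and (φ ψ : Formula)
  | or (φ ψ : Formula)
  | ex (x : ℕ) (φ : Formula)

namespace Formula

/-- Free variables. -/
def fv : Formula → Finset ℕ
  | tru => ∅
  | atom _ ts => ts.foldr (fun t s => t.vars ∪ s) ∅
  | eq s t => s.vars ∪ t.vars
  | neg φ => φ.fv
  | and φ ψ => φ.fv ∪ ψ.fv
  | or φ ψ => φ.fv ∪ ψ.fv
  | ex x φ => φ.fv.erase x

/-- Constants that occur in the formula. -/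
def consts : Formula → Finset ℕ
  | tru => ∅
  | atom _ ts => ts.foldr (fun t s => t.consts ∪ s) ∅
  | eq s t => s.consts ∪ t.consts
  | neg φ => φ.consts
  | and φ ψ => φ.consts ∪ ψ.consts
  | or φ ψ => φ.consts ∪ ψ.consts
  | ex _ φ => φ.consts

/-- All atoms use relation symbols of the schema with the right number of arguments. -/
def OverSchema (schema : List ℕ) : Formula → Prop
  | tru => True
  | atom R ts => schema[R]? = some ts.length
  | eq _ _ => True
  | neg φ => φ.OverSchema schema
  | and φ ψ => φ.OverSchema schema ∧ ψ.OverSchema schema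
  | or φ ψ => φ.OverSchema schema ∧ ψ.OverSchema schema
  | ex _ φ => φ.OverSchema schema

/-- Replace each free occurrence of a variable `x ∈ P` by the constant `σ x`. -/
def subst (σ : ℕ → ℕ) : Finset ℕ → Formula → Formula
  | _, tru => tru
  | P, atom R ts => atom R (ts.map (Term.subst P σ))
  | P, eq s t => eq (s.subst P σ) (t.subst P σ)
  | P, neg φ => neg (φ.subst σ P)
  | P, and φ ψ => and (φ.subst σ P) (ψ.subst σ P)
  | P, or φ ψ => or (φ.subst σ P) (ψ.subst σ P)
  | P, ex x φ => ex x (φ.subst σ (P.erase x))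

/-- Satisfaction in the instance `I` under the valuation `v`, with quantifiers ranging over `D`. -/
def Holds (D : Set ℕ) (I : Instance) : (ℕ → ℕ) → Formula → Prop
  | _, tru => True
  | v, atom R ts => (R, ts.map (Term.eval v)) ∈ I
  | v, eq s t => s.eval v = t.eval v
  | v, neg φ => ¬ Holds D I v φ
  | v, and φ ψ => Holds D I v φ ∧ Holds D I v ψ
  | v, or φ ψ => Holds D I v φ ∨ Holds D I v ψ
  | v, ex x φ => ∃ d ∈ D, Holds D I (Function.update v x d) φ

/-- The answers of a query evaluated over the domain `D`.  A valuation is a total function of which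
only the values at the free variables of the query matter. -/
def ansOver (D : Set ℕ) (Q : Formula) (I : Instance) : Set (ℕ → ℕ) :=
  {v | (∀ x ∈ Q.fv, v x ∈ D) ∧ Holds D I v Q}

/-- The active domain of a query and an instance: the constants of either. -/
def queryDom (Q : Formula) (I : Instance) : Set ℕ := adom I ∪ (Q.consts : Set ℕ)

/-- The answers of a query under the active-domain semantics. -/
def ans (Q : Formula) (I : Instance) : Set (ℕ → ℕ) := Q.ansOver (Q.queryDom I) I

/-- Domain independence: on every (finite) instance of the schema, the answers do not depend on the
domain of evaluation, as long as it holds all constants of the query and of the instance. -/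
def DomainIndependent (schema : List ℕ) (Q : Formula) : Prop :=
  ∀ I : Instance, I.Finite → Conforms schema I →
    ∀ D : Set ℕ, Q.queryDom I ⊆ D → Q.ansOver D I = Q.ans I

end Formula

/-- A conjunctive query: existentially quantified variables and a list of relational atoms. -/
structure CQ where
  bound : List ℕ
  atoms : List (ℕ × List Term)

def CQ.toFormula (q : CQ) : Formula :=
  q.bound.foldr Formula.ex
    (q.atoms.foldr (fun A φ => Formula.and (Formula.atom A.1 A.2) φ) Formula.tru)

/-- A union of conjunctive queries. -/
abbrev UCQ : Type := List CQ

def UCQ.toFormula (q : UCQ) : Formula :=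
  q.foldr (fun c φ => Formula.or c.toFormula φ) (Formula.neg Formula.tru)

/-! ### Data layer -/

/-- An equality constraint `Q → ⋀ z = y`. -/
structure EqConstraint where
  query : Formula
  eqs : List (Term × Term)

def EqConstraint.Sat (e : EqConstraint) (I : Instance) : Prop :=
  ∀ v ∈ e.query.ans I, ∀ p ∈ e.eqs, p.1.eval v = p.2.eval v

/-- A data layer.  `schema` lists the arities of the relations. -/
structure DataLayer where
  schema : List ℕ
  constraints : List EqConstraint
  init : List Fact
  init_conforms : Conforms schema {F | F ∈ init}
  constraints_wf : ∀ e ∈ constraints,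
    e.query.OverSchema schema ∧ e.query.DomainIndependent schema ∧
    (e.query.consts : Set ℕ) ⊆ adom {F | F ∈ init} ∧
    ∀ p ∈ e.eqs, p.1.vars ∪ p.2.vars ⊆ e.query.fv ∧
      ((p.1.consts ∪ p.2.consts : Finset ℕ) : Set ℕ) ⊆ adom {F | F ∈ init}
  init_sat : ∀ e ∈ constraints, e.Sat {F | F ∈ init}

/-- The initial instance. -/
def DataLayer.initInstance (D : DataLayer) : Instance := {F | F ∈ D.init}

/-! ### Process layer -/

/-- A term in the head of an effect: a term, or a service call on terms. -/
inductive EffTerm : Type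
  | base (t : Term)
  | call (f : ℕ) (ts : List Term)

namespace EffTerm

def vars : EffTerm → Finset ℕ
  | base t => t.vars
  | call _ ts => ts.foldr (fun t s => t.vars ∪ s) ∅

def consts : EffTerm → Finset ℕ
  | base t => t.consts
  | call _ ts => ts.foldr (fun t s => t.consts ∪ s) ∅

def OverServices (services : List ℕ) : EffTerm → Prop
  | base _ => True
  | call f ts => services[f]? = some ts.length

end EffTerm

/-- An effect specification `q⁺ ∧ Q⁻ ⇝ E`. -/
structure Effect where
  pos : UCQ
  filter : Formula
  head : List (ℕ × List EffTerm)

/-- The query `q⁺ ∧ Q⁻` of an effect specification. -/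
def Effect.query (e : Effect) : Formula := Formula.and e.pos.toFormula e.filter

/-- An action: its input parameters, which are variables, and its effect specifications. -/
structure Action where
  params : List ℕ
  effects : List Effect

/-- A condition-action rule `Q ↦ α`; the action is given by its position in the list of actions. -/
structure Rule where
  guard : Formula
  action : ℕ

/-- Well-formedness of an effect of an action with parameters `P`, where `A` is the set of the
constants that may be used. -/
def Effect.WellFormed (schema services : List ℕ) (A : Set ℕ) (P : Finset ℕ) (e : Effect) : Prop :=
  e.query.OverSchema schema ∧
  (e.query.consts : Set ℕ) ⊆ A ∧
  (∀ c ∈ e.pos, ∀ c' ∈ e.pos, c.toFormula.fv \ P = c'.toFormula.fv \ P) ∧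
  e.filter.fv ⊆ e.pos.toFormula.fv ∪ P ∧
  ∀ F ∈ e.head, schema[F.1]? = some F.2.length ∧
    ∀ t ∈ F.2, t.OverServices services ∧ (t.consts : Set ℕ) ⊆ A ∧
      t.vars ⊆ e.pos.toFormula.fv ∪ P

/-- A process layer over a data layer.  `services` lists the arities of the external services. -/
structure ProcessLayer (D : DataLayer) where
  services : List ℕ
  actions : List Action
  rules : List Rule
  actions_wf : ∀ α ∈ actions, α.params.Nodup ∧
    ∀ e ∈ α.effects, e.WellFormed D.schema services (adom D.initInstance) α.params.toFinset
  rules_wf : ∀ r ∈ rules, r.guard.OverSchema D.schema ∧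
    (r.guard.consts : Set ℕ) ⊆ adom D.initInstance ∧
    ∃ α, actions[r.action]? = some α ∧ r.guard.fv = α.params.toFinset

end DataCentric

open DataCentric in
/-- A (relational) data-centric dynamic system. -/
structure DCDS where
  data : DataLayer
  process : ProcessLayer data

namespace DataCentric

/-! ### Transition systems and run-boundedness -/

/-- A transition system whose states are labelled by instances. -/
structure TransitionSystem where
  State : Type
  init : State
  db : State → Instance
  step : State → State → Prop

/-- A finite or infinite run `s₀ s₁ s₂ ⋯`; its positions are the `i` with `i ≤ last`. -/
structure TransitionSystem.Run (T : TransitionSystem) where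
  last : ℕ∞
  state : ℕ → T.State
  state_zero : state 0 = T.init
  step : ∀ i : ℕ, ((i + 1 : ℕ) : ℕ∞) ≤ last → T.step (state i) (state (i + 1))

/-- The values that occur in the databases along a run. -/
def TransitionSystem.Run.values {T : TransitionSystem} (τ : T.Run) : Set ℕ :=
  {c | ∃ i : ℕ, (i : ℕ∞) ≤ τ.last ∧ c ∈ adom (T.db (τ.state i))}

/-- A single bound works for all runs. -/
def TransitionSystem.RunBounded (T : TransitionSystem) : Prop :=
  ∃ b : ℕ, ∀ τ : T.Run, τ.values.encard < b

/-! ### Semantics with deterministic services -/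

/-- A service call `f(v₁,…,vₙ)` on values. -/
abbrev ServiceCall : Type := ℕ × List ℕ

/-- A service call map: a partial function from service calls to values. -/
abbrev CallMap : Type := ServiceCall → Option ℕ

/-- A ground term: a value or a service call. -/
inductive GroundTerm : Type
  | val (c : ℕ)
  | call (t : ServiceCall)

def EffTerm.ground (v : ℕ → ℕ) : EffTerm → GroundTerm
  | base t => GroundTerm.val (t.eval v)
  | call f ts => GroundTerm.call (f, ts.map (Term.eval v))

/-- `Interprets M t c`: the ground term `t` denotes the value `c` under the service call map. -/
def Interprets (M : CallMap) : GroundTerm → ℕ → Prop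
  | GroundTerm.val c', c => c = c'
  | GroundTerm.call t, c => M t = some c

/-- The set of ground facts, possibly with service calls, that an action produces from `I` under
the parameter assignment `σ`. -/
def doAction (I : Instance) (α : Action) (σ : ℕ → ℕ) : Set (ℕ × List GroundTerm) :=
  {F | ∃ e ∈ α.effects, ∃ θ ∈ (e.query.subst σ α.params.toFinset).ans I, ∃ H ∈ e.head,
    F = (H.1, H.2.map (EffTerm.ground (fun x => if x ∈ α.params then σ x else θ x)))}

/-- The service calls that occur in a set of ground facts. -/
def callsIn (E : Set (ℕ × List GroundTerm)) : Set ServiceCall :=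
  {t | ∃ F ∈ E, GroundTerm.call t ∈ F.2}

/-- Application of a service call map to a set of ground facts. -/
def CallMap.apply (M : CallMap) (E : Set (ℕ × List GroundTerm)) : Instance :=
  {G | ∃ F ∈ E, G.1 = F.1 ∧ List.Forall₂ (Interprets M) F.2 G.2}

/-- `M'` is a possible outcome of issuing the calls in `calls` when `M` holds the results so far:
known results are kept, and exactly the new calls receive arbitrary values. -/
def CallMap.IsExtension (M M' : CallMap) (calls : Set ServiceCall) : Prop :=
  (∀ t c, M t = some c → M' t = some c) ∧
  ∀ t, (M' t).isSome ↔ (M t).isSome ∨ t ∈ calls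

/-- A concrete state: an instance and a service call map. -/
structure ConcreteState where
  inst : Instance
  calls : CallMap

end DataCentric

namespace DCDS

open DataCentric

def initState (S : DCDS) : ConcreteState := ⟨S.data.initInstance, fun _ => none⟩

/-- Concrete execution of an action, under a rule with guard `Q`, with the parameters `σ`. -/
def Exec (S : DCDS) (Q : Formula) (α : Action) (σ : ℕ → ℕ) (s s' : ConcreteState) : Prop :=
  σ ∈ Q.ans s.inst ∧
  s.calls.IsExtension s'.calls (callsIn (doAction s.inst α σ)) ∧
  s'.inst = s'.calls.apply (doAction s.inst α σ) ∧
  ∀ e ∈ S.data.constraints, e.Sat s'.inst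

def Step (S : DCDS) (s s' : ConcreteState) : Prop :=
  ∃ r ∈ S.process.rules, ∃ α, S.process.actions[r.action]? = some α ∧
    ∃ σ, S.Exec r.guard α σ s s'

/-- The states of the concrete transition system. -/
inductive IsState (S : DCDS) : ConcreteState → Prop
  | init : IsState S S.initState
  | step {s s' : ConcreteState} : IsState S s → S.Step s s' → IsState S s'

/-- The concrete transition system of a DCDS with deterministic services. -/
def concreteTS (S : DCDS) : TransitionSystem where
  State := {s : ConcreteState // S.IsState s}
  init := ⟨S.initState, IsState.init⟩
  db s := s.1.inst
  step s s' := S.Step s.1 s'.1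

/-- A DCDS with deterministic services is run-bounded if its concrete transition system is. -/
def RunBounded (S : DCDS) : Prop := S.concreteTS.RunBounded

end DCDS

namespace DataCentric

/-! ### Descriptions of DCDSs as input of algorithms

A DCDS is a finite object, built from naturals by pairs, lists and the term and formula
constructors; it is numbered along this construction. -/

instance : Encodable Term :=
  Encodable.ofEquiv (ℕ ⊕ ℕ)
    { toFun := fun t => match t with
        | Term.var x => Sum.inl x
        | Term.const c => Sum.inr c
      invFun := Sum.elim Term.var Term.const
      left_inv := fun t => by cases t <;> rfl
      right_inv := fun t => by cases t <;> rfl }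

/-- Gödel number of a formula. -/
def Formula.code : Formula → ℕ
  | tru => Nat.pair 0 0
  | atom R ts => Nat.pair 1 (Encodable.encode (R, ts))
  | eq s t => Nat.pair 2 (Encodable.encode (s, t))
  | neg φ => Nat.pair 3 φ.code
  | and φ ψ => Nat.pair 4 (Nat.pair φ.code ψ.code)
  | or φ ψ => Nat.pair 5 (Nat.pair φ.code ψ.code)
  | ex x φ => Nat.pair 6 (Nat.pair x φ.code)

theorem Formula.code_injective : Function.Injective Formula.code := by
  intro φ
  induction φ with
  | tru => intro ψ h; cases ψ <;> simp_all [Formula.code, Nat.pair_eq_pair]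
  | atom R ts => intro ψ h; cases ψ <;> simp_all [Formula.code, Nat.pair_eq_pair]
  | eq s t => intro ψ h; cases ψ <;> simp_all [Formula.code, Nat.pair_eq_pair]
  | neg φ ih =>
    intro ψ h
    cases ψ <;> simp only [Formula.code, Nat.pair_eq_pair] at h <;> try omega
    rw [ih h.2]
  | and φ χ ih1 ih2 =>
    intro ψ h
    cases ψ <;> simp only [Formula.code, Nat.pair_eq_pair] at h <;> try omega
    rw [ih1 h.2.1, ih2 h.2.2]
  | or φ χ ih1 ih2 =>
    intro ψ h
    cases ψ <;> simp only [Formula.code, Nat.pair_eq_pair] at h <;> try omega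
    rw [ih1 h.2.1, ih2 h.2.2]
  | ex x φ ih =>
    intro ψ h
    cases ψ <;> simp only [Formula.code, Nat.pair_eq_pair] at h <;> try omega
    rw [h.2.1, ih h.2.2]

noncomputable instance : Encodable Formula := Encodable.ofInj Formula.code Formula.code_injective

instance : Encodable CQ :=
  Encodable.ofEquiv (List ℕ × List (ℕ × List Term))
    ⟨fun q => (q.bound, q.atoms), fun p => ⟨p.1, p.2⟩, fun _ => rfl, fun _ => rfl⟩

noncomputable instance : Encodable EqConstraint :=
  Encodable.ofEquiv (Formula × List (Term × Term))
    ⟨fun e => (e.query, e.eqs), fun p => ⟨p.1, p.2⟩, fun _ => rfl, fun _ => rfl⟩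

instance : Encodable EffTerm :=
  Encodable.ofEquiv (Term ⊕ (ℕ × List Term))
    { toFun := fun t => match t with
        | EffTerm.base t => Sum.inl t
        | EffTerm.call f ts => Sum.inr (f, ts)
      invFun := Sum.elim EffTerm.base (fun p => EffTerm.call p.1 p.2)
      left_inv := fun t => by cases t <;> rfl
      right_inv := fun t => by rcases t with t | ⟨f, ts⟩ <;> rfl }

noncomputable instance : Encodable Effect :=
  Encodable.ofEquiv (List CQ × Formula × List (ℕ × List EffTerm))
    ⟨fun e => (e.pos, e.filter, e.head), fun p => ⟨p.1, p.2.1, p.2.2⟩, fun _ => rfl, fun _ => rfl⟩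

noncomputable instance : Encodable Action :=
  Encodable.ofEquiv (List ℕ × List Effect)
    ⟨fun α => (α.params, α.effects), fun p => ⟨p.1, p.2⟩, fun _ => rfl, fun _ => rfl⟩

noncomputable instance : Encodable Rule :=
  Encodable.ofEquiv (Formula × ℕ)
    ⟨fun r => (r.guard, r.action), fun p => ⟨p.1, p.2⟩, fun _ => rfl, fun _ => rfl⟩

end DataCentric

namespace DCDS

open DataCentric

/-- The finite data that make up a DCDS. -/
def description (S : DCDS) :
    (List ℕ × List EqConstraint × List Fact) × (List ℕ × List Action × List Rule) :=
  ((S.data.schema, S.data.constraints, S.data.init),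
    (S.process.services, S.process.actions, S.process.rules))

theorem description_injective : Function.Injective DCDS.description := by
  rintro ⟨⟨a, b, c, _, _, _⟩, ⟨d, e, f, _, _⟩⟩ ⟨⟨a', b', c', _, _, _⟩, ⟨d', e', f', _, _⟩⟩ h
  simp only [description, Prod.mk.injEq] at h
  obtain ⟨⟨rfl, rfl, rfl⟩, rfl, rfl, rfl⟩ := h
  rfl

noncomputable instance : Encodable DCDS := Encodable.ofInj description description_injective

end DCDS

/-- A property `P` of finitely describable objects is decidable if some algorithm, given the number
of an object `a`, answers whether `P a` holds.  Nothing is required of the algorithm on inputs that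
are not the number of an object. -/
def AlgorithmicallyDecidable {α : Type} [Encodable α] (P : α → Prop) : Prop :=
  ∃ p : ℕ → Prop, ComputablePred p ∧ ∀ a : α, p (Encodable.encode a) ↔ P a

namespace DataCentric

/-! ### Horn rules as effects -/

/-! The halting problem reduces to run-boundedness. For a code `u` and an input `n`, the system
`evalDCDS u n` has one parameterless action whose effects are a positive Datalog program for
evaluating partial recursive functions. A further effect appends one element to a successor chain by
calling a unary service on the current top element. The only guard says that no result has been
derived. A transition is thus one parallel round of all rules together with one growth step.

The difficulty is that the service may return anything, including old values, so a run need not work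
on a true copy of the numbers. Consider the ideal run, in which the service is the successor
function and whose stages are `evalStage`. Bodies of rules are conjunctions of atoms, so
homomorphisms preserve derivations, and every run is stage by stage a homomorphic image of the ideal
one, up to extra facts (`exists_hom_evalStage`).

If `u` halts at `n`, completeness (`eventually_halt`) puts a result into some ideal stage `T`. Every
run then has a result at stage `T` at the latest, is blocked there, and holds a bounded number of
values. If `u` does not halt at `n`, soundness (`trueFact_evalStage`) shows that the ideal run never
derives a result; it is an infinite run through infinitely many values. With `u` universal and
fixed, only the initial instance depends on the input, which makes the reduction computable. -/

theorem Term.subst_empty (σ : ℕ → ℕ) : Term.subst ∅ σ = id := by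
  funext t
  cases t <;> simp [Term.subst]

theorem Formula.subst_empty (σ : ℕ → ℕ) (φ : Formula) : φ.subst σ ∅ = φ := by
  induction φ <;> simp_all [Formula.subst, Term.subst_empty]

/-- The instance under `v` of an atom `A`, that is, of a relation symbol with a list of variables. -/
def instAtom (v : ℕ → ℕ) (A : Fact) : Fact := (A.1, A.2.map v)

/-- The conjunction of a list of atoms, as a query without quantifiers. -/
def conj (As : List Fact) : UCQ := [⟨[], As.map fun A => (A.1, A.2.map Term.var)⟩]

theorem holds_conj {D : Set ℕ} {I : Instance} {v : ℕ → ℕ} {As : List Fact} :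
    Formula.Holds D I v (UCQ.toFormula (conj As)) ↔ ∀ A ∈ As, instAtom v A ∈ I := by
  simp only [UCQ.toFormula, conj, List.foldr, Formula.Holds, CQ.toFormula, not_true, or_false]
  induction As with
  | nil => simp [Formula.Holds]
  | cons A As ih =>
    simp only [List.map_cons, List.foldr_cons, Formula.Holds, ih, List.forall_mem_cons,
      List.map_map]
    rfl

theorem foldr_vars (xs : List ℕ) :
    (xs.map Term.var).foldr (fun t s => t.vars ∪ s) ∅ = xs.toFinset := by
  induction xs with
  | nil => rfl
  | cons x xs ih =>
    rw [List.map_cons, List.foldr_cons, ih, List.toFinset_cons, Finset.insert_eq, Term.vars]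

theorem foldr_consts (xs : List ℕ) :
    (xs.map Term.var).foldr (fun t s => t.consts ∪ s) ∅ = ∅ := by
  induction xs with
  | nil => rfl
  | cons x xs ih => rw [List.map_cons, List.foldr_cons, ih, Term.consts, Finset.union_empty]

theorem mem_fv_conj {As : List Fact} {x : ℕ} :
    x ∈ (UCQ.toFormula (conj As)).fv ↔ ∃ A ∈ As, x ∈ A.2 := by
  simp only [UCQ.toFormula, conj, List.foldr, Formula.fv, CQ.toFormula, Finset.union_empty]
  induction As with
  | nil => simp [Formula.fv]
  | cons A As ih => simp [Formula.fv, ih, foldr_vars]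

theorem consts_conj (As : List Fact) : (UCQ.toFormula (conj As)).consts = ∅ := by
  simp only [UCQ.toFormula, conj, List.foldr, Formula.consts, CQ.toFormula, Finset.union_empty]
  induction As with
  | nil => rfl
  | cons A As ih => simp [Formula.consts, ih, foldr_consts]

theorem overSchema_conj {schema : List ℕ} {As : List Fact}
    (h : ∀ A ∈ As, schema[A.1]? = some A.2.length) :
    (UCQ.toFormula (conj As)).OverSchema schema := by
  simp only [UCQ.toFormula, conj, List.foldr, Formula.OverSchema, CQ.toFormula, and_true]
  induction As with
  | nil => trivial
  | cons A As ih =>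
    simp only [List.forall_mem_cons] at h
    simpa [Formula.OverSchema, h.1] using ih h.2

/-- The answers of a conjunction of atoms, used as an effect with trivial filter. -/
theorem mem_ans_conj {As : List Fact} {I : Instance} {v : ℕ → ℕ} :
    v ∈ (Formula.and (UCQ.toFormula (conj As)) Formula.tru).ans I ↔
      ∀ A ∈ As, instAtom v A ∈ I := by
  simp only [Formula.ans, Formula.ansOver, Set.mem_ofPred_eq, Formula.Holds, holds_conj, and_true,
    Formula.fv, Finset.union_empty, mem_fv_conj, and_iff_right_iff_imp]
  rintro h x ⟨A, hA, hx⟩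
  exact Or.inl ⟨_, h A hA, List.mem_map_of_mem hx⟩

/-- A Horn rule; relation symbols are applied to variables. -/
structure HornRule where
  body : List Fact
  head : Fact

/-- Conformity to the schema, and range restriction. -/
def HornRule.WellFormed (schema : List ℕ) (r : HornRule) : Prop :=
  (∀ A ∈ r.body, schema[A.1]? = some A.2.length) ∧
  schema[r.head.1]? = some r.head.2.length ∧ ∀ x ∈ r.head.2, ∃ A ∈ r.body, x ∈ A.2

/-- The effect that derives the head of a rule from its body. -/
def HornRule.effect (r : HornRule) : Effect :=
  ⟨conj r.body, Formula.tru, [(r.head.1, r.head.2.map fun x => EffTerm.base (Term.var x))]⟩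

theorem HornRule.effect_wellFormed {schema services : List ℕ} {A : Set ℕ} {r : HornRule}
    (h : r.WellFormed schema) : r.effect.WellFormed schema services A ∅ := by
  refine ⟨⟨overSchema_conj h.1, trivial⟩, ?_, ?_, ?_, ?_⟩
  · simp [Effect.query, effect, Formula.consts, consts_conj]
  · simp [effect, conj]
  · simp [effect, Formula.fv]
  · simp only [effect, List.mem_singleton, forall_eq, List.length_map, List.mem_map,
      forall_exists_index, and_imp, forall_apply_eq_imp_iff₂]
    refine ⟨h.2.1, fun x hx => ⟨trivial, by simp [EffTerm.consts, Term.consts], ?_⟩⟩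
    simpa [EffTerm.vars, Term.vars, mem_fv_conj] using h.2.2 x hx

/-- The effect that prolongs the successor relation `0` beyond the element marked by relation `1`,
through a call of service `0`. -/
def growEffect : Effect :=
  ⟨conj [(1, [0])], Formula.tru,
    [(0, [EffTerm.base (Term.var 0), EffTerm.call 0 [Term.var 0]]),
      (1, [EffTerm.call 0 [Term.var 0]])]⟩

theorem growEffect_wellFormed {schema : List ℕ} {A : Set ℕ} (h0 : schema[0]? = some 2)
    (h1 : schema[1]? = some 1) : growEffect.WellFormed schema [1] A ∅ := by
  refine ⟨⟨overSchema_conj (by simpa using h1), trivial⟩, ?_, ?_, ?_, ?_⟩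
  · simp [Effect.query, growEffect, Formula.consts, consts_conj]
  · simp [growEffect, conj]
  · simp [growEffect, Formula.fv]
  · simp [growEffect, EffTerm.OverServices, EffTerm.consts, EffTerm.vars, Term.consts, Term.vars,
      h0, h1, mem_fv_conj]

/-- One parallel round of the rules, where the new element after the marked one is given by `g`. -/
def nextInst (rules : List HornRule) (g : ℕ → ℕ) (I : Instance) : Instance :=
  {F | (∃ r ∈ rules, ∃ v, (∀ A ∈ r.body, instAtom v A ∈ I) ∧ F = instAtom v r.head) ∨
    ∃ x, (1, [x]) ∈ I ∧ (F = (0, [x, g x]) ∨ F = (1, [g x]))}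

/-- Without parameters there is nothing to choose in a step except the values of new service calls:
all effects fire together for all their answers. -/
def hornAction (rules : List HornRule) : Action :=
  ⟨[], rules.map HornRule.effect ++ [growEffect]⟩

theorem mem_doAction {rules : List HornRule} {I : Instance} {σ : ℕ → ℕ}
    {F : ℕ × List GroundTerm} :
    F ∈ doAction I (hornAction rules) σ ↔
      (∃ r ∈ rules, ∃ v, (∀ A ∈ r.body, instAtom v A ∈ I) ∧
        F = (r.head.1, r.head.2.map fun x => GroundTerm.val (v x))) ∨
      ∃ x, (1, [x]) ∈ I ∧ (F = (0, [GroundTerm.val x, GroundTerm.call (0, [x])]) ∨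
        F = (1, [GroundTerm.call (0, [x])])) := by
  simp only [doAction, hornAction, List.mem_append, List.mem_map, List.mem_singleton,
    List.toFinset_nil, Formula.subst_empty, Set.mem_ofPred_eq, or_and_right, exists_or,
    exists_eq_left, List.not_mem_nil, if_false]
  refine or_congr ?_ ?_
  · constructor
    · rintro ⟨_, ⟨r, hr, rfl⟩, v, hv, H, hH, rfl⟩
      refine ⟨r, hr, v, mem_ans_conj.1 hv, ?_⟩
      simp only [HornRule.effect, List.mem_singleton] at hH
      subst hH
      simp [EffTerm.ground, Term.eval, Function.comp_def]
    · rintro ⟨r, hr, v, hv, rfl⟩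
      refine ⟨_, ⟨r, hr, rfl⟩, v, mem_ans_conj.2 hv, _, List.mem_singleton_self _, ?_⟩
      simp [EffTerm.ground, Term.eval, Function.comp_def]
  · constructor
    · rintro ⟨v, hv, H, hH, rfl⟩
      refine ⟨v 0, by simpa [instAtom] using mem_ans_conj.1 hv, ?_⟩
      simp only [growEffect, List.mem_cons, List.not_mem_nil, or_false] at hH
      rcases hH with rfl | rfl <;> simp [EffTerm.ground, Term.eval]
    · rintro ⟨x, hx, hF⟩
      refine ⟨fun _ => x, mem_ans_conj.2 (by simpa [instAtom] using hx), ?_⟩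
      simp only [growEffect, List.mem_cons, List.not_mem_nil, or_false, exists_eq_or_imp,
        exists_eq_left]
      simpa [EffTerm.ground, Term.eval] using hF

/-- Only `growEffect` calls the service, and both of its head atoms contain the same call. -/
theorem callsIn_doAction {rules : List HornRule} {I : Instance} {σ : ℕ → ℕ} :
    callsIn (doAction I (hornAction rules) σ) = {t | ∃ x, (1, [x]) ∈ I ∧ t = (0, [x])} := by
  ext t
  constructor
  · rintro ⟨F, hF, ht⟩
    rcases mem_doAction.1 hF with ⟨r, -, v, -, rfl⟩ | ⟨x, hx, rfl | rfl⟩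
    · simp at ht
    · exact ⟨x, hx, by simpa using ht⟩
    · exact ⟨x, hx, by simpa using ht⟩
  · rintro ⟨x, hx, rfl⟩
    exact ⟨_, mem_doAction.2 (Or.inr ⟨x, hx, Or.inr rfl⟩), by simp⟩

theorem forall₂_interprets_val {M : CallMap} {v : ℕ → ℕ} {xs ys : List ℕ} :
    List.Forall₂ (Interprets M) (xs.map fun x => GroundTerm.val (v x)) ys ↔ ys = xs.map v := by
  induction xs generalizing ys with
  | nil => simp
  | cons x xs ih => cases ys <;> simp [ih, Interprets]

/-- The calls that occur all have marked elements as arguments, so the call map matters only there.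
-/
theorem apply_doAction {rules : List HornRule} {I : Instance} {σ g : ℕ → ℕ} {M : CallMap}
    (hM : ∀ x, (1, [x]) ∈ I → M (0, [x]) = some (g x)) :
    M.apply (doAction I (hornAction rules) σ) = nextInst rules g I := by
  ext ⟨R, ys⟩
  constructor
  · rintro ⟨F, hF, hR, hys⟩
    rcases mem_doAction.1 hF with ⟨r, hr, v, hv, rfl⟩ | ⟨x, hx, rfl | rfl⟩
    · obtain rfl := forall₂_interprets_val.1 hys
      exact Or.inl ⟨r, hr, v, hv, Prod.ext hR rfl⟩
    · rcases hys with _ | ⟨h1, _ | ⟨h2, _ | _⟩⟩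
      simp only [Interprets, hM x hx, Option.some.injEq] at h1 h2
      exact Or.inr ⟨x, hx, Or.inl (by simp_all)⟩
    · rcases hys with _ | ⟨h2, _ | _⟩
      simp only [Interprets, hM x hx, Option.some.injEq] at h2
      exact Or.inr ⟨x, hx, Or.inr (by simp_all)⟩
  · rintro (⟨r, hr, v, hv, h⟩ | ⟨x, hx, h | h⟩)
    · cases h
      exact ⟨_, mem_doAction.2 (Or.inl ⟨r, hr, v, hv, rfl⟩), rfl, forall₂_interprets_val.2 rfl⟩
    · cases h
      exact ⟨_, mem_doAction.2 (Or.inr ⟨x, hx, Or.inl rfl⟩), rfl, by simp [Interprets, hM x hx]⟩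
    · cases h
      exact ⟨_, mem_doAction.2 (Or.inr ⟨x, hx, Or.inr rfl⟩), rfl, by simp [Interprets, hM x hx]⟩

/-- A homomorphism into an instance that takes the new element to the new element is one between
the next stages. -/
theorem instAtom_mem_nextInst {rules : List HornRule} {g g' e : ℕ → ℕ} {I J : Instance}
    (h : ∀ F ∈ I, instAtom e F ∈ J) (hg : ∀ x, (1, [x]) ∈ I → e (g x) = g' (e x)) :
    ∀ F ∈ nextInst rules g I, instAtom e F ∈ nextInst rules g' J := by
  rintro F (⟨r, hr, v, hv, rfl⟩ | ⟨x, hx, hF⟩)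
  · refine Or.inl ⟨r, hr, e ∘ v, fun A hA => ?_, by simp [instAtom]⟩
    simpa [instAtom] using h _ (hv A hA)
  · refine Or.inr ⟨e x, h _ hx, ?_⟩
    rcases hF with rfl | rfl <;> simp [instAtom, hg x hx]

/-- By range restriction a Horn rule creates no values; only growth does. -/
theorem adom_nextInst {rules : List HornRule} {schema : List ℕ}
    (hr : ∀ r ∈ rules, r.WellFormed schema) {g : ℕ → ℕ} {I : Instance} :
    adom (nextInst rules g I) ⊆ adom I ∪ {y | ∃ x, (1, [x]) ∈ I ∧ y = g x} := by
  rintro c ⟨F, ⟨r, hr', v, hv, rfl⟩ | ⟨x, hx, hF⟩, hc⟩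
  · obtain ⟨y, hy, rfl⟩ := List.mem_map.1 hc
    obtain ⟨A, hA, hyA⟩ := (hr r hr').2.2 y hy
    exact Or.inl ⟨_, hv A hA, List.mem_map_of_mem hyA⟩
  · have : c = x ∨ c = g x := by rcases hF with rfl | rfl <;> simp_all
    rcases this with rfl | rfl
    · exact Or.inl ⟨_, hx, by simp⟩
    · exact Or.inr ⟨x, hx, rfl⟩

end DataCentric

namespace DataCentric

open Nat.Partrec Encodable Denumerable

/-! ### A Horn program for partial recursive functions

Codes of partial recursive functions are represented by their numbers; the subcodes of the code to
be evaluated are listed in the initial instance. -/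

/-- `y` is the successor of `x`. -/
abbrev succAtom (x y : ℕ) : Fact := (0, [x, y])
/-- `x` is the largest number present so far. -/
abbrev topAtom (x : ℕ) : Fact := (1, [x])
/-- `x` is zero. -/
abbrev zeroAtom (x : ℕ) : Fact := (2, [x])
/-- `x < y`. -/
abbrev ltAtom (x y : ℕ) : Fact := (3, [x, y])
/-- `z` is the number of the pair of `x` and `y`. -/
abbrev pairAtom (x y z : ℕ) : Fact := (4, [x, y, z])
/-- The code `c` evaluates to `y` at `x`. -/
abbrev evalAtom (c x y : ℕ) : Fact := (5, [c, x, y])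
abbrev codeZeroAtom (c : ℕ) : Fact := (6, [c])
abbrev codeSuccAtom (c : ℕ) : Fact := (7, [c])
abbrev codeLeftAtom (c : ℕ) : Fact := (8, [c])
abbrev codeRightAtom (c : ℕ) : Fact := (9, [c])
abbrev codePairAtom (c f g : ℕ) : Fact := (10, [c, f, g])
abbrev codeCompAtom (c f g : ℕ) : Fact := (11, [c, f, g])
abbrev codePrecAtom (c f g : ℕ) : Fact := (12, [c, f, g])
abbrev codeFindAtom (c f : ℕ) : Fact := (13, [c, f])
/-- The code `c` is to be evaluated at `x`. -/
abbrev startAtom (c x : ℕ) : Fact := (14, [c, x])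
/-- The evaluation has given the result `y`. -/
abbrev haltAtom (y : ℕ) : Fact := (15, [y])

def evalSchema : List ℕ := [2, 1, 1, 2, 3, 3, 1, 1, 1, 1, 3, 3, 3, 2, 2, 1]

/-- Rules that keep the facts about successor, zero, codes and the start. -/
def copyRules : List HornRule :=
  [succAtom 0 1, zeroAtom 0, codeZeroAtom 0, codeSuccAtom 0, codeLeftAtom 0, codeRightAtom 0,
    codePairAtom 0 1 2, codeCompAtom 0 1 2, codePrecAtom 0 1 2, codeFindAtom 0 1,
    startAtom 0 1].map fun A => ⟨[A], A⟩

/-- Rules for order and for the pairing function. -/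
def arithRules : List HornRule :=
  [⟨[succAtom 0 1], ltAtom 0 1⟩,
    ⟨[ltAtom 0 1, succAtom 1 2], ltAtom 0 2⟩,
    ⟨[zeroAtom 0], pairAtom 0 0 0⟩,
    ⟨[pairAtom 0 1 2, succAtom 0 3, ltAtom 3 1, succAtom 2 4], pairAtom 3 1 4⟩,
    ⟨[pairAtom 0 1 2, succAtom 0 1, zeroAtom 3, succAtom 2 4], pairAtom 1 3 4⟩,
    ⟨[pairAtom 0 1 2, ltAtom 1 0, succAtom 1 3, succAtom 2 4], pairAtom 0 3 4⟩,
    ⟨[pairAtom 0 0 1, zeroAtom 2, succAtom 0 3, succAtom 1 4], pairAtom 2 3 4⟩]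

/-- Rules for evaluation. -/
def codeRules : List HornRule :=
  -- The atom `succAtom 2 3` only serves range restriction: it binds the argument `2`, and every
  -- number eventually has a successor.
  [⟨[codeZeroAtom 0, zeroAtom 1, succAtom 2 3], evalAtom 0 2 1⟩,
    ⟨[codeSuccAtom 0, succAtom 1 2], evalAtom 0 1 2⟩,
    ⟨[codeLeftAtom 0, pairAtom 1 2 3], evalAtom 0 3 1⟩,
    ⟨[codeRightAtom 0, pairAtom 1 2 3], evalAtom 0 3 2⟩,
    ⟨[codePairAtom 0 1 2, evalAtom 1 3 4, evalAtom 2 3 5, pairAtom 4 5 6], evalAtom 0 3 6⟩,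
    ⟨[codeCompAtom 0 1 2, evalAtom 2 3 4, evalAtom 1 4 5], evalAtom 0 3 5⟩,
    ⟨[codePrecAtom 0 1 2, evalAtom 1 3 4, zeroAtom 5, pairAtom 3 5 6], evalAtom 0 6 4⟩,
    ⟨[codePrecAtom 0 1 2, pairAtom 3 4 5, evalAtom 0 5 6, pairAtom 4 6 7, pairAtom 3 7 8,
      evalAtom 2 8 9, succAtom 4 10, pairAtom 3 10 11], evalAtom 0 11 9⟩,
    ⟨[codeFindAtom 0 1, pairAtom 2 3 4, zeroAtom 5, evalAtom 1 4 5], evalAtom 0 4 3⟩,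
    ⟨[codeFindAtom 0 1, pairAtom 2 3 4, succAtom 5 6, evalAtom 1 4 6, succAtom 3 7,
      pairAtom 2 7 8, evalAtom 0 8 9], evalAtom 0 4 9⟩,
    ⟨[startAtom 0 1, evalAtom 0 1 2], haltAtom 2⟩]

def evalRules : List HornRule := copyRules ++ arithRules ++ codeRules

theorem evalRules_wellFormed : ∀ r ∈ evalRules, r.WellFormed evalSchema := by
  simp only [HornRule.WellFormed]
  decide

/-! #### Soundness -/

/-- Counting the failed tests `n` turns the search into a recursion that makes one test at a time,
as the two search rules do. A failed test must have a defined nonzero value, hence the form `k + 1`.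
-/
theorem mem_eval_rfind' {f : Code} {a m y : ℕ} :
    y ∈ (Code.rfind' f).eval (Nat.pair a m) ↔
      ∃ n, y = n + m ∧ 0 ∈ f.eval (Nat.pair a (n + m)) ∧
        ∀ j < n, ∃ k, k + 1 ∈ f.eval (Nat.pair a (j + m)) := by
  have hz : ∀ j b, b ∈ ((fun x => decide (x = 0)) <$> f.eval (Nat.pair a (j + m)) : Part Bool) ↔
      ∃ x ∈ f.eval (Nat.pair a (j + m)), decide (x = 0) = b := fun j b => by
    rw [Part.map_eq_map, Part.mem_map_iff]
  have he : (Code.rfind' f).eval (Nat.pair a m) = (Nat.rfind fun n =>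
      (fun x => decide (x = 0)) <$> f.eval (Nat.pair a (n + m))).map (· + m) := by
    simp [Code.eval]
  rw [he, Part.mem_map_iff]
  refine exists_congr fun n => ⟨fun ⟨hn, hy⟩ => ?_, fun ⟨hy, h0, h⟩ => ⟨?_, hy.symm⟩⟩
  · obtain ⟨h0, h⟩ := Nat.mem_rfind.1 hn
    obtain ⟨x, hx, hx0⟩ := (hz n true).1 h0
    obtain rfl := of_decide_eq_true hx0
    refine ⟨hy.symm, hx, fun j hj => ?_⟩
    obtain ⟨k, hk, hk0⟩ := (hz j false).1 (h hj)
    obtain ⟨k, rfl⟩ := Nat.exists_eq_succ_of_ne_zero (of_decide_eq_false hk0)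
    exact ⟨k, hk⟩
  · refine Nat.mem_rfind.2 ⟨(hz n true).2 ⟨0, h0, rfl⟩, fun {j} hj => (hz j false).2 ?_⟩
    obtain ⟨k, hk⟩ := h j hj
    exact ⟨_, hk, by simp⟩

/-- The intended meaning of the facts, when the code `u` is to be evaluated at `n`. -/
def TrueFact (u : Code) (n : ℕ) : Fact → Prop
  | (0, [x, y]) => y = x + 1
  | (1, [_]) => True
  | (2, [x]) => x = 0
  | (3, [x, y]) => x < y
  | (4, [x, y, z]) => z = Nat.pair x y
  | (5, [c, x, y]) => y ∈ (ofNat Code c).eval x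
  | (6, [c]) => ofNat Code c = Code.zero
  | (7, [c]) => ofNat Code c = Code.succ
  | (8, [c]) => ofNat Code c = Code.left
  | (9, [c]) => ofNat Code c = Code.right
  | (10, [c, f, g]) => ofNat Code c = Code.pair (ofNat Code f) (ofNat Code g)
  | (11, [c, f, g]) => ofNat Code c = Code.comp (ofNat Code f) (ofNat Code g)
  | (12, [c, f, g]) => ofNat Code c = Code.prec (ofNat Code f) (ofNat Code g)
  | (13, [c, f]) => ofNat Code c = Code.rfind' (ofNat Code f)
  | (14, [c, x]) => ofNat Code c = u ∧ x = n
  | (15, [_]) => (u.eval n).Dom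
  | _ => False

/-- This recurrence and the next three describe the step from one pair to the next in the
enumeration by `Nat.pair`. They cover all pairs but `(0, 0)` and justify the four step rules for
`pairAtom`. -/
theorem pair_succ_left {a b : ℕ} (h : a + 1 < b) : Nat.pair (a + 1) b = Nat.pair a b + 1 := by
  rw [Nat.pair, Nat.pair, if_pos h, if_pos (by omega)]; omega

theorem pair_succ_zero (a : ℕ) : Nat.pair (a + 1) 0 = Nat.pair a (a + 1) + 1 := by
  rw [Nat.pair, Nat.pair, if_neg (by omega), if_pos (by omega)]; ring

theorem pair_succ_right {a b : ℕ} (h : b < a) : Nat.pair a (b + 1) = Nat.pair a b + 1 := by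
  rw [Nat.pair, Nat.pair, if_neg (by omega), if_neg (by omega)]; omega

theorem pair_zero_succ (a : ℕ) : Nat.pair 0 (a + 1) = Nat.pair a a + 1 := by
  rw [Nat.pair, Nat.pair, if_pos (by omega), if_neg (by omega)]; ring

theorem trueFact_copyRules {u : Code} {n : ℕ} : ∀ r ∈ copyRules, ∀ v,
    (∀ A ∈ r.body, TrueFact u n (instAtom v A)) → TrueFact u n (instAtom v r.head) := by
  intro r hr v h
  obtain ⟨A, -, rfl⟩ := List.mem_map.1 hr
  exact h A (List.mem_singleton_self A)

theorem trueFact_arithRules {u : Code} {n : ℕ} : ∀ r ∈ arithRules, ∀ v,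
    (∀ A ∈ r.body, TrueFact u n (instAtom v A)) → TrueFact u n (instAtom v r.head) := by
  simp only [arithRules, List.forall_mem_cons, instAtom, List.map_cons, List.map_nil, TrueFact,
    List.not_mem_nil, false_imp_iff, implies_true, and_true]
  refine ⟨?_, ?_, ?_, ?_, ?_, ?_, ?_⟩ <;> intro v h
  · omega
  · omega
  · simp [h, Nat.pair]
  · obtain ⟨h1, h2, h3, h4⟩ := h
    rw [h2] at h3 ⊢
    rw [h4, h1, pair_succ_left h3]
  · obtain ⟨h1, h2, h3, h4⟩ := h
    rw [h4, h1, h3, h2, pair_succ_zero]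
  · obtain ⟨h1, h2, h3, h4⟩ := h
    rw [h4, h1, h3, pair_succ_right h2]
  · obtain ⟨h1, h2, h3, h4⟩ := h
    rw [h4, h1, h3, h2, pair_zero_succ]

/-- Each evaluation rule is a defining equation of `Code.eval`, read from right to left. -/
theorem trueFact_codeRules {u : Code} {n : ℕ} : ∀ r ∈ codeRules, ∀ v,
    (∀ A ∈ r.body, TrueFact u n (instAtom v A)) → TrueFact u n (instAtom v r.head) := by
  simp only [codeRules, List.forall_mem_cons, instAtom, List.map_cons, List.map_nil, TrueFact,
    List.not_mem_nil, false_imp_iff, implies_true, and_true]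
  refine ⟨?_, ?_, ?_, ?_, ?_, ?_, ?_, ?_, ?_, ?_, ?_⟩ <;> intro v h
  · rw [h.1, h.2.1]
    exact Part.mem_some 0
  · rw [h.1, h.2]
    exact Part.mem_some _
  · rw [h.1, h.2]
    simp [Code.eval]
  · rw [h.1, h.2]
    simp [Code.eval]
  · obtain ⟨h1, h2, h3, h4⟩ := h
    rw [h1, h4]
    have he : ((ofNat Code (v 1)).pair (ofNat Code (v 2))).eval (v 3) =
      Nat.pair <$> (ofNat Code (v 1)).eval (v 3) <*> (ofNat Code (v 2)).eval (v 3) := rfl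
    simp only [he, Seq.seq, Part.map_eq_map, Part.mem_bind_iff, Part.mem_map_iff]
    exact ⟨_, ⟨_, h2, rfl⟩, _, h3, rfl⟩
  · obtain ⟨h1, h2, h3⟩ := h
    rw [h1]
    exact Part.mem_bind h2 h3
  · obtain ⟨h1, h2, h3, h4⟩ := h
    rw [h1, h4, h3, Code.eval_prec_zero]
    exact h2
  · obtain ⟨h1, h2, h3, h4, h5, h6, h7, h8⟩ := h
    rw [h1] at h3 ⊢
    rw [h8, h7, Code.eval_prec_succ]
    rw [h5, h4] at h6
    rw [h2] at h3
    exact Part.mem_bind h3 h6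
  · obtain ⟨h1, h2, h3, h4⟩ := h
    rw [h1, h2, mem_eval_rfind']
    rw [h2, h3] at h4
    exact ⟨0, by simp, by simpa using h4, by simp⟩
  · obtain ⟨h1, h2, h3, h4, h5, h6, h7⟩ := h
    rw [h1] at h7 ⊢
    rw [h6, h5, mem_eval_rfind'] at h7
    rw [h2, mem_eval_rfind']
    rw [h2, h3] at h4
    obtain ⟨k, hk, h0, h⟩ := h7
    -- The test at `v 3` comes before the search from `v 3 + 1`: it is the case `j = 0`, and the
    -- earlier tests are shifted by one.
    refine ⟨k + 1, by omega, by rwa [add_right_comm, add_assoc], fun j hj => ?_⟩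
    rcases j with _ | j
    · exact ⟨_, by simpa using h4⟩
    · rw [add_right_comm, add_assoc]
      exact h j (by omega)
  · obtain ⟨⟨h1, h2⟩, h3⟩ := h
    rw [h1, h2] at h3
    exact Part.dom_iff_mem.2 ⟨_, h3⟩

theorem trueFact_evalRules {u : Code} {n : ℕ} : ∀ r ∈ evalRules, ∀ v,
    (∀ A ∈ r.body, TrueFact u n (instAtom v A)) → TrueFact u n (instAtom v r.head) := by
  intro r hr
  rcases List.mem_append.1 hr with hr | hr
  · rcases List.mem_append.1 hr with hr | hr
    · exact trueFact_copyRules r hr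
    · exact trueFact_arithRules r hr
  · exact trueFact_codeRules r hr

/-! ### The initial instance -/

/-- The facts about all subcodes of a code. -/
def subcodeFacts : Code → List Fact
  | Code.zero => [codeZeroAtom (encode Code.zero)]
  | Code.succ => [codeSuccAtom (encode Code.succ)]
  | Code.left => [codeLeftAtom (encode Code.left)]
  | Code.right => [codeRightAtom (encode Code.right)]
  | Code.pair f g => codePairAtom (encode (Code.pair f g)) (encode f) (encode g) ::
      (subcodeFacts f ++ subcodeFacts g)
  | Code.comp f g => codeCompAtom (encode (Code.comp f g)) (encode f) (encode g) ::
      (subcodeFacts f ++ subcodeFacts g)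
  | Code.prec f g => codePrecAtom (encode (Code.prec f g)) (encode f) (encode g) ::
      (subcodeFacts f ++ subcodeFacts g)
  | Code.rfind' f => codeFindAtom (encode (Code.rfind' f)) (encode f) :: subcodeFacts f

/-- The initial facts: the numbers up to `n + encode u`, the subcodes of `u`, and the start. -/
def evalInit (u : Code) (n : ℕ) : List Fact :=
  (List.range (n + encode u)).map (fun i => succAtom i (i + 1)) ++
    topAtom (n + encode u) :: zeroAtom 0 :: startAtom (encode u) n :: subcodeFacts u

theorem trueFact_subcodeFacts {u c : Code} {n : ℕ} : ∀ F ∈ subcodeFacts c, TrueFact u n F := by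
  induction c <;>
    simp_all [subcodeFacts, TrueFact, or_imp]

theorem trueFact_evalInit {u : Code} {n : ℕ} : ∀ F ∈ evalInit u n, TrueFact u n F := by
  simp only [evalInit, List.mem_append, List.mem_cons, List.mem_map]
  rintro F (⟨i, -, rfl⟩ | rfl | rfl | rfl | hF)
  · rfl
  · trivial
  · rfl
  · exact ⟨ofNat_encode u, rfl⟩
  · exact trueFact_subcodeFacts F hF

theorem conforms_subcodeFacts (c : Code) :
    ∀ F ∈ subcodeFacts c, evalSchema[F.1]? = some F.2.length := by
  induction c with
  | zero => exact List.forall_mem_singleton.2 rfl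
  | succ => exact List.forall_mem_singleton.2 rfl
  | left => exact List.forall_mem_singleton.2 rfl
  | right => exact List.forall_mem_singleton.2 rfl
  | pair f g hf hg => exact List.forall_mem_cons.2 ⟨rfl, List.forall_mem_append.2 ⟨hf, hg⟩⟩
  | comp f g hf hg => exact List.forall_mem_cons.2 ⟨rfl, List.forall_mem_append.2 ⟨hf, hg⟩⟩
  | prec f g hf hg => exact List.forall_mem_cons.2 ⟨rfl, List.forall_mem_append.2 ⟨hf, hg⟩⟩
  | rfind' f hf => exact List.forall_mem_cons.2 ⟨rfl, hf⟩

theorem conforms_evalInit (u : Code) (n : ℕ) : Conforms evalSchema {F | F ∈ evalInit u n} := by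
  simp only [Conforms, evalInit, List.mem_append, List.mem_cons, List.mem_map, Set.mem_ofPred_eq]
  rintro F (⟨i, -, rfl⟩ | rfl | rfl | rfl | hF)
  · rfl
  · rfl
  · rfl
  · rfl
  · exact conforms_subcodeFacts u F hF

/-- Subcodes have smaller numbers. The clause `F.1 ≠ 1` is kept for the uniqueness of the marked
element. -/
theorem le_of_mem_subcodeFacts {c : Code} :
    ∀ F ∈ subcodeFacts c, F.1 ≠ 1 ∧ ∀ x ∈ F.2, x ≤ encode c := by
  have mono : ∀ {a b : Code} {l : List Fact}, encode a < encode b →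
      (∀ F ∈ l, F.1 ≠ 1 ∧ ∀ x ∈ F.2, x ≤ encode a) →
      ∀ F ∈ l, F.1 ≠ 1 ∧ ∀ x ∈ F.2, x ≤ encode b :=
    fun hab h F hF => ⟨(h F hF).1, fun x hx => ((h F hF).2 x hx).trans hab.le⟩
  induction c with
  | zero => simp [subcodeFacts]
  | succ => simp [subcodeFacts]
  | left => simp [subcodeFacts]
  | right => simp [subcodeFacts]
  | pair f g hf hg =>
    have := Code.encode_lt_pair f g
    simp only [subcodeFacts, List.forall_mem_cons, List.forall_mem_append]
    exact ⟨by simp [this.1.le, this.2.le], mono this.1 hf, mono this.2 hg⟩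
  | comp f g hf hg =>
    have := Code.encode_lt_comp f g
    simp only [subcodeFacts, List.forall_mem_cons, List.forall_mem_append]
    exact ⟨by simp [this.1.le, this.2.le], mono this.1 hf, mono this.2 hg⟩
  | prec f g hf hg =>
    have := Code.encode_lt_prec f g
    simp only [subcodeFacts, List.forall_mem_cons, List.forall_mem_append]
    exact ⟨by simp [this.1.le, this.2.le], mono this.1 hf, mono this.2 hg⟩
  | rfind' f hf =>
    have := Code.encode_lt_rfind' f
    simp only [subcodeFacts, List.forall_mem_cons]
    exact ⟨by simp [this.le], mono this hf⟩

/-- This is why the initial chain reaches `n + encode u`: numbers of codes are constants too, and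
all initial constants must lie in the segment that the homomorphism to an arbitrary run fixes. -/
theorem le_of_mem_evalInit {u : Code} {n : ℕ} :
    ∀ F ∈ evalInit u n, ∀ x ∈ F.2, x ≤ n + encode u := by
  simp only [evalInit, List.mem_append, List.mem_cons, List.mem_map, List.mem_range]
  rintro F (⟨i, hi, rfl⟩ | rfl | rfl | rfl | hF) x hx
  · simp at hx; omega
  · simp at hx; omega
  · simp at hx; omega
  · simp at hx; omega
  · have := (le_of_mem_subcodeFacts F hF).2 x hx; omega

theorem top_mem_evalInit {u : Code} {n x : ℕ} :
    (1, [x]) ∈ evalInit u n ↔ x = n + encode u := by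
  simp only [evalInit, List.mem_append, List.mem_cons, List.mem_map, Prod.mk.injEq]
  constructor
  · rintro (⟨i, -, h, -⟩ | h | h | h | h)
    · simp at h
    · simpa using h
    · simp at h
    · simp at h
    · exact absurd rfl (le_of_mem_subcodeFacts _ h).1
  · rintro rfl
    simp

end DataCentric

namespace DataCentric

open Nat.Partrec Encodable Denumerable

/-! #### Completeness -/

/-- The successive stages of the evaluation. -/
def evalStage (u : Code) (n : ℕ) : ℕ → Instance
  | 0 => {F | F ∈ evalInit u n}
  | k + 1 => nextInst evalRules Nat.succ (evalStage u n k)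

theorem trueFact_evalStage {u : Code} {n k : ℕ} : ∀ F ∈ evalStage u n k, TrueFact u n F := by
  induction k with
  | zero => exact trueFact_evalInit
  | succ k ih =>
    rintro F (⟨r, hr, v, hv, rfl⟩ | ⟨x, -, rfl | rfl⟩)
    · exact trueFact_evalRules r hr v fun A hA => ih _ (hv A hA)
    · rfl
    · trivial

/-- Hence only growth moves the mark, and each stage has exactly one marked element. -/
theorem head_ne_top : ∀ r ∈ evalRules, r.head.1 ≠ 1 := by decide

theorem top_mem_nextInst {g : ℕ → ℕ} {I : Instance} {y : ℕ} :
    (1, [y]) ∈ nextInst evalRules g I ↔ ∃ x, (1, [x]) ∈ I ∧ y = g x := by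
  constructor
  · rintro (⟨r, hr, v, -, h⟩ | ⟨x, hx, h | h⟩)
    · exact absurd (congrArg Prod.fst h).symm (head_ne_top r hr)
    · simp at h
    · exact ⟨x, hx, by simpa using h⟩
  · rintro ⟨x, hx, rfl⟩
    exact Or.inr ⟨x, hx, Or.inr rfl⟩

theorem top_mem_evalStage {u : Code} {n k x : ℕ} :
    (1, [x]) ∈ evalStage u n k ↔ x = n + encode u + k := by
  induction k generalizing x with
  | zero => exact top_mem_evalInit
  | succ k ih =>
    rw [evalStage, top_mem_nextInst]
    simp only [ih, exists_eq_left]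
    rfl

/-- The fact belongs to all stages from some point on. -/
def Eventually (u : Code) (n : ℕ) (F : Fact) : Prop := ∃ k, ∀ j ≥ k, F ∈ evalStage u n j

section

variable {u : Code} {n : ℕ}

theorem eventually_forall {l : List Fact} (h : ∀ F ∈ l, Eventually u n F) :
    ∃ k, ∀ j ≥ k, ∀ F ∈ l, F ∈ evalStage u n j := by
  induction l with
  | nil => exact ⟨0, by simp⟩
  | cons F l ih =>
    rw [List.forall_mem_cons] at h
    obtain ⟨k, hk⟩ := h.1
    obtain ⟨k', hk'⟩ := ih h.2
    refine ⟨max k k', fun j hj => List.forall_mem_cons.2 ⟨hk j ?_, hk' j ?_⟩⟩ <;> omega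

/-- Stages are not cumulative: a derived fact survives only by being derived again. Once all
premises are permanent, the rule fires in every later round and its conclusion is permanent too. -/
theorem Eventually.of_rule {r : HornRule} (hr : r ∈ evalRules) (v : ℕ → ℕ)
    (h : ∀ A ∈ r.body, Eventually u n (instAtom v A)) : Eventually u n (instAtom v r.head) := by
  obtain ⟨k, hk⟩ := eventually_forall (l := r.body.map (instAtom v))
    (List.forall_mem_map.2 h)
  refine ⟨k + 1, fun j hj => ?_⟩
  obtain ⟨j, rfl⟩ := Nat.exists_eq_add_of_le' (show 1 ≤ j by omega)
  exact Or.inl ⟨r, hr, v, fun A hA => hk j (by omega) _ (List.mem_map_of_mem hA), rfl⟩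

/-- Application of a rule to elements listed in the order of the variables. -/
theorem Eventually.rule (xs : List ℕ) {F : Fact} (r : HornRule) (hr : r ∈ evalRules)
    (hF : instAtom (fun i => xs.getD i 0) r.head = F)
    (h : ∀ A ∈ r.body, Eventually u n (instAtom (fun i => xs.getD i 0) A)) :
    Eventually u n F :=
  hF ▸ of_rule hr _ h

/-- The body of a copy rule is its own head, so one occurrence reproduces itself forever. -/
theorem eventually_of_copy {r : HornRule} (hr : r ∈ copyRules) (v : ℕ → ℕ) {k : ℕ}
    (h : instAtom v r.head ∈ evalStage u n k) : Eventually u n (instAtom v r.head) := by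
  refine ⟨k, fun j hj => Nat.le_induction h (fun j _ ih => Or.inl ⟨r, ?_, v, ?_, rfl⟩) j hj⟩
  · exact List.mem_append_left _ (List.mem_append_left _ hr)
  · obtain ⟨A, -, rfl⟩ := List.mem_map.1 hr
    simpa using ih

theorem eventually_succ (x : ℕ) : Eventually u n (succAtom x (x + 1)) := by
  have key : ∃ k, succAtom x (x + 1) ∈ evalStage u n k := by
    rcases lt_or_ge x (n + encode u) with h | h
    · refine ⟨0, List.mem_append_left _ ?_⟩
      exact List.mem_map.2 ⟨x, List.mem_range.2 h, rfl⟩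
    · obtain ⟨k, rfl⟩ := Nat.exists_eq_add_of_le h
      -- At stage `k` the marked element is `n + encode u + k`, and the next growth step adds its
      -- successor.
      exact ⟨k + 1, Or.inr ⟨_, top_mem_evalStage.2 rfl, Or.inl rfl⟩⟩
  obtain ⟨k, hk⟩ := key
  exact eventually_of_copy (r := ⟨[succAtom 0 1], succAtom 0 1⟩) (by simp [copyRules])
    (fun i => [x, x + 1].getD i 0) hk

theorem eventually_zero : Eventually u n (zeroAtom 0) :=
  eventually_of_copy (r := ⟨[zeroAtom 0], zeroAtom 0⟩) (k := 0) (by simp [copyRules])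
    (fun _ => 0) (by simp [evalStage, evalInit, instAtom])

theorem eventually_start : Eventually u n (startAtom (encode u) n) :=
  eventually_of_copy (r := ⟨[startAtom 0 1], startAtom 0 1⟩) (k := 0) (by simp [copyRules])
    (fun i => [encode u, n].getD i 0) (by simp [evalStage, evalInit, instAtom])

theorem subcodeFacts_copied (c : Code) :
    ∀ F ∈ subcodeFacts c, ∃ r ∈ copyRules, ∃ v, instAtom v r.head = F := by
  have h3 : ∀ R ∈ [10, 11, 12], ∀ a b d, ∃ r ∈ copyRules, ∃ v, instAtom v r.head = (R, [a, b, d]) :=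
    fun R hR a b d => ⟨⟨[(R, [0, 1, 2])], (R, [0, 1, 2])⟩, by
      simp only [List.mem_cons, List.not_mem_nil, or_false] at hR
      rcases hR with rfl | rfl | rfl <;> simp [copyRules], fun i => [a, b, d].getD i 0, rfl⟩
  have h1 : ∀ R ∈ [6, 7, 8, 9], ∀ a, ∃ r ∈ copyRules, ∃ v, instAtom v r.head = (R, [a]) :=
    fun R hR a => ⟨⟨[(R, [0])], (R, [0])⟩, by
      simp only [List.mem_cons, List.not_mem_nil, or_false] at hR
      rcases hR with rfl | rfl | rfl | rfl <;> simp [copyRules], fun _ => a, rfl⟩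
  induction c with
  | zero => exact List.forall_mem_singleton.2 (h1 _ (by simp) _)
  | succ => exact List.forall_mem_singleton.2 (h1 _ (by simp) _)
  | left => exact List.forall_mem_singleton.2 (h1 _ (by simp) _)
  | right => exact List.forall_mem_singleton.2 (h1 _ (by simp) _)
  | pair f g hf hg =>
    exact List.forall_mem_cons.2 ⟨h3 _ (by simp) _ _ _, List.forall_mem_append.2 ⟨hf, hg⟩⟩
  | comp f g hf hg =>
    exact List.forall_mem_cons.2 ⟨h3 _ (by simp) _ _ _, List.forall_mem_append.2 ⟨hf, hg⟩⟩
  | prec f g hf hg =>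
    exact List.forall_mem_cons.2 ⟨h3 _ (by simp) _ _ _, List.forall_mem_append.2 ⟨hf, hg⟩⟩
  | rfind' f hf =>
    exact List.forall_mem_cons.2 ⟨⟨⟨[codeFindAtom 0 1], codeFindAtom 0 1⟩, by simp [copyRules],
      fun i => [encode (Code.rfind' f), encode f].getD i 0, rfl⟩, hf⟩

theorem eventually_subcodeFacts : ∀ F ∈ subcodeFacts u, Eventually u n F := by
  intro F hF
  obtain ⟨r, hr, v, rfl⟩ := subcodeFacts_copied u F hF
  exact eventually_of_copy (k := 0) hr v (by simp [evalStage, evalInit, hF])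

theorem eventually_lt {x y : ℕ} (h : x < y) : Eventually u n (ltAtom x y) := by
  induction y, h using Nat.le_induction with
  | base =>
    exact .rule [x, x + 1] ⟨[succAtom 0 1], ltAtom 0 1⟩ (by simp [evalRules, arithRules]) rfl
      (by simpa [instAtom] using eventually_succ x)
  | succ y hy ih =>
    exact .rule [x, y, y + 1] ⟨[ltAtom 0 1, succAtom 1 2], ltAtom 0 2⟩
      (by simp [evalRules, arithRules]) rfl (by simpa [instAtom] using ⟨ih, eventually_succ y⟩)

/-- Induction on the number of the pair; the cases are the four recurrences of `Nat.pair`. -/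
theorem eventually_pair (a b : ℕ) : Eventually u n (pairAtom a b (Nat.pair a b)) := by
  induction hz : Nat.pair a b generalizing a b with
  | zero =>
    obtain ⟨rfl, rfl⟩ := Nat.pair_eq_pair.1 (hz.trans (show 0 = Nat.pair 0 0 from rfl))
    exact .rule [0] ⟨[zeroAtom 0], pairAtom 0 0 0⟩ (by simp [evalRules, arithRules]) rfl
      (by simpa [instAtom] using eventually_zero)
  | succ z ih =>
    rcases lt_or_ge a b with hab | hab
    · rcases a with _ | a
      · obtain ⟨b, rfl⟩ := Nat.exists_eq_add_of_le' hab
        rw [Nat.succ_eq_add_one, zero_add, pair_zero_succ, Nat.succ_inj] at hz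
        exact .rule [b, z, 0, b + 1, z + 1]
          ⟨[pairAtom 0 0 1, zeroAtom 2, succAtom 0 3, succAtom 1 4], pairAtom 2 3 4⟩
          (by simp [evalRules, arithRules]) rfl
          (by simpa [instAtom] using ⟨ih b b hz, eventually_zero, eventually_succ b,
            eventually_succ z⟩)
      · rw [pair_succ_left hab, Nat.succ_inj] at hz
        exact .rule [a, b, z, a + 1, z + 1]
          ⟨[pairAtom 0 1 2, succAtom 0 3, ltAtom 3 1, succAtom 2 4], pairAtom 3 1 4⟩
          (by simp [evalRules, arithRules]) rfl
          (by simpa [instAtom] using ⟨ih a b hz, eventually_succ a, eventually_lt hab,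
            eventually_succ z⟩)
    · rcases b with _ | b
      · rcases a with _ | a
        · exact absurd hz (by simp [Nat.pair])
        · rw [pair_succ_zero, Nat.succ_inj] at hz
          exact .rule [a, a + 1, z, 0, z + 1]
            ⟨[pairAtom 0 1 2, succAtom 0 1, zeroAtom 3, succAtom 2 4], pairAtom 1 3 4⟩
            (by simp [evalRules, arithRules]) rfl
            (by simpa [instAtom] using ⟨ih a _ hz, eventually_succ a, eventually_zero,
              eventually_succ z⟩)
      · rw [pair_succ_right hab, Nat.succ_inj] at hz
        exact .rule [a, b, z, b + 1, z + 1]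
          ⟨[pairAtom 0 1 2, ltAtom 1 0, succAtom 1 3, succAtom 2 4], pairAtom 0 3 4⟩
          (by simp [evalRules, arithRules]) rfl
          (by simpa [instAtom] using ⟨ih a b hz, eventually_lt hab, eventually_succ b,
            eventually_succ z⟩)

theorem eventually_eval_prec {f g : Code}
    (hc : Eventually u n (codePrecAtom (encode (Code.prec f g)) (encode f) (encode g)))
    (hf : ∀ x, ∀ y ∈ f.eval x, Eventually u n (evalAtom (encode f) x y))
    (hg : ∀ x, ∀ y ∈ g.eval x, Eventually u n (evalAtom (encode g) x y)) (a m : ℕ) :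
    ∀ y ∈ (Code.prec f g).eval (Nat.pair a m),
      Eventually u n (evalAtom (encode (Code.prec f g)) (Nat.pair a m) y) := by
  induction m with
  | zero =>
    intro y hy
    rw [Code.eval_prec_zero] at hy
    exact .rule [encode (Code.prec f g), encode f, encode g, a, y, 0, Nat.pair a 0]
      ⟨[codePrecAtom 0 1 2, evalAtom 1 3 4, zeroAtom 5, pairAtom 3 5 6], evalAtom 0 6 4⟩
      (by simp [evalRules, codeRules]) rfl
      (by simpa [instAtom] using ⟨hc, hf a y hy, eventually_zero, eventually_pair a 0⟩)
  | succ m ih =>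
    intro y hy
    rw [Code.eval_prec_succ] at hy
    obtain ⟨w, hw, hy⟩ := Part.mem_bind_iff.1 hy
    exact .rule [encode (Code.prec f g), encode f, encode g, a, m, Nat.pair a m, w, Nat.pair m w,
        Nat.pair a (Nat.pair m w), y, m + 1, Nat.pair a (m + 1)]
      ⟨[codePrecAtom 0 1 2, pairAtom 3 4 5, evalAtom 0 5 6, pairAtom 4 6 7, pairAtom 3 7 8,
        evalAtom 2 8 9, succAtom 4 10, pairAtom 3 10 11], evalAtom 0 11 9⟩
      (by simp [evalRules, codeRules]) rfl
      (by simpa [instAtom] using ⟨hc, eventually_pair a m, ih w hw, eventually_pair m w,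
        eventually_pair _ _, hg _ y hy, eventually_succ m, eventually_pair _ _⟩)

/-- Induction on the number `k` of failed tests. The starting point `m` varies, since after a failed
test the search resumes at `m + 1`. -/
theorem eventually_eval_rfind' {f : Code}
    (hc : Eventually u n (codeFindAtom (encode (Code.rfind' f)) (encode f)))
    (hf : ∀ x, ∀ y ∈ f.eval x, Eventually u n (evalAtom (encode f) x y)) (a m k : ℕ)
    (h0 : 0 ∈ f.eval (Nat.pair a (k + m)))
    (h : ∀ j < k, ∃ x, x + 1 ∈ f.eval (Nat.pair a (j + m))) :
    Eventually u n (evalAtom (encode (Code.rfind' f)) (Nat.pair a m) (k + m)) := by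
  induction k generalizing m with
  | zero =>
    rw [zero_add] at h0 ⊢
    exact .rule [encode (Code.rfind' f), encode f, a, m, Nat.pair a m, 0]
      ⟨[codeFindAtom 0 1, pairAtom 2 3 4, zeroAtom 5, evalAtom 1 4 5], evalAtom 0 4 3⟩
      (by simp [evalRules, codeRules]) rfl
      (by simpa [instAtom] using ⟨hc, eventually_pair a m, eventually_zero, hf _ _ h0⟩)
  | succ k ih =>
    have e : ∀ j, j + 1 + m = j + (m + 1) := fun j => by omega
    obtain ⟨x, hx⟩ := h 0 k.succ_pos
    rw [zero_add] at hx
    rw [e] at h0 ⊢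
    have := ih (m + 1) h0 fun j hj => by simpa only [e] using h (j + 1) (by omega)
    exact .rule [encode (Code.rfind' f), encode f, a, m, Nat.pair a m, x, x + 1, m + 1,
        Nat.pair a (m + 1), k + (m + 1)]
      ⟨[codeFindAtom 0 1, pairAtom 2 3 4, succAtom 5 6, evalAtom 1 4 6, succAtom 3 7,
        pairAtom 2 7 8, evalAtom 0 8 9], evalAtom 0 4 9⟩
      (by simp [evalRules, codeRules]) rfl
      (by simpa [instAtom] using ⟨hc, eventually_pair a m, eventually_succ x, hf _ _ hx,
        eventually_succ m, eventually_pair _ _, this⟩)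

/-- Structural induction on `c`. The hypothesis is about the subcodes of `c` alone, because the
instance describes only the subcodes of `u`. -/
theorem eventually_eval {c : Code} (hc : ∀ F ∈ subcodeFacts c, Eventually u n F) (x : ℕ) :
    ∀ y ∈ c.eval x, Eventually u n (evalAtom (encode c) x y) := by
  induction c generalizing x with
  | zero =>
    rintro y hy
    obtain rfl := Part.mem_some_iff.1 (show y ∈ Part.some 0 from hy)
    exact .rule [encode Code.zero, 0, x, x + 1]
      ⟨[codeZeroAtom 0, zeroAtom 1, succAtom 2 3], evalAtom 0 2 1⟩
      (by simp [evalRules, codeRules]) rfl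
      (by simpa [instAtom] using ⟨hc _ (List.mem_singleton_self _), eventually_zero,
        eventually_succ x⟩)
  | succ =>
    rintro y hy
    obtain rfl := Part.mem_some_iff.1 (show y ∈ Part.some (x + 1) from hy)
    exact .rule [encode Code.succ, x, x + 1]
      ⟨[codeSuccAtom 0, succAtom 1 2], evalAtom 0 1 2⟩
      (by simp [evalRules, codeRules]) rfl
      (by simpa [instAtom] using ⟨hc _ (List.mem_singleton_self _), eventually_succ x⟩)
  | left =>
    rintro y hy
    obtain rfl := Part.mem_some_iff.1 (show y ∈ Part.some x.unpair.1 from hy)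
    have := eventually_pair (u := u) (n := n) x.unpair.1 x.unpair.2
    rw [Nat.pair_unpair] at this
    exact .rule [encode Code.left, x.unpair.1, x.unpair.2, x]
      ⟨[codeLeftAtom 0, pairAtom 1 2 3], evalAtom 0 3 1⟩
      (by simp [evalRules, codeRules]) rfl
      (by simpa [instAtom] using ⟨hc _ (List.mem_singleton_self _), this⟩)
  | right =>
    rintro y hy
    obtain rfl := Part.mem_some_iff.1 (show y ∈ Part.some x.unpair.2 from hy)
    have := eventually_pair (u := u) (n := n) x.unpair.1 x.unpair.2
    rw [Nat.pair_unpair] at this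
    exact .rule [encode Code.right, x.unpair.1, x.unpair.2, x]
      ⟨[codeRightAtom 0, pairAtom 1 2 3], evalAtom 0 3 2⟩
      (by simp [evalRules, codeRules]) rfl
      (by simpa [instAtom] using ⟨hc _ (List.mem_singleton_self _), this⟩)
  | pair f g hf hg =>
    simp only [subcodeFacts, List.forall_mem_cons, List.forall_mem_append] at hc
    intro y hy
    have he : (Code.pair f g).eval x = Nat.pair <$> f.eval x <*> g.eval x := rfl
    simp only [he, Seq.seq, Part.map_eq_map, Part.mem_bind_iff, Part.mem_map_iff] at hy
    obtain ⟨_, ⟨a, ha, rfl⟩, b, hb, rfl⟩ := hy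
    exact .rule [encode (Code.pair f g), encode f, encode g, x, a, b, Nat.pair a b]
      ⟨[codePairAtom 0 1 2, evalAtom 1 3 4, evalAtom 2 3 5, pairAtom 4 5 6], evalAtom 0 3 6⟩
      (by simp [evalRules, codeRules]) rfl
      (by simpa [instAtom] using ⟨hc.1, hf hc.2.1 x a ha, hg hc.2.2 x b hb, eventually_pair a b⟩)
  | comp f g hf hg =>
    simp only [subcodeFacts, List.forall_mem_cons, List.forall_mem_append] at hc
    intro y hy
    obtain ⟨w, hw, hy⟩ := Part.mem_bind_iff.1 (show y ∈ (g.eval x).bind f.eval from hy)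
    exact .rule [encode (Code.comp f g), encode f, encode g, x, w, y]
      ⟨[codeCompAtom 0 1 2, evalAtom 2 3 4, evalAtom 1 4 5], evalAtom 0 3 5⟩
      (by simp [evalRules, codeRules]) rfl
      (by simpa [instAtom] using ⟨hc.1, hg hc.2.2 x w hw, hf hc.2.1 w y hy⟩)
  | prec f g hf hg =>
    simp only [subcodeFacts, List.forall_mem_cons, List.forall_mem_append] at hc
    rw [← Nat.pair_unpair x]
    exact eventually_eval_prec hc.1 (hf hc.2.1) (hg hc.2.2) _ _
  | rfind' f hf =>
    simp only [subcodeFacts, List.forall_mem_cons] at hc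
    intro y hy
    rw [← Nat.pair_unpair x] at hy ⊢
    obtain ⟨k, rfl, h0, h⟩ := mem_eval_rfind'.1 hy
    exact eventually_eval_rfind' hc.1 (hf hc.2) _ _ k h0 h

theorem eventually_halt (h : (u.eval n).Dom) : ∃ k y, haltAtom y ∈ evalStage u n k := by
  obtain ⟨y, hy⟩ := Part.dom_iff_mem.1 h
  have : Eventually u n (haltAtom y) :=
    .rule [encode u, n, y] ⟨[startAtom 0 1, evalAtom 0 1 2], haltAtom 2⟩
      (by simp [evalRules, codeRules]) rfl
      (by simpa [instAtom] using ⟨eventually_start, eventually_eval eventually_subcodeFacts n y hy⟩)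
  obtain ⟨k, hk⟩ := this
  exact ⟨k, y, hk k le_rfl⟩

end

end DataCentric

namespace DataCentric

open Nat.Partrec Encodable Denumerable

/-! ### The reduction -/

/-- The condition that the evaluation has given no result yet. -/
def notHalted : Formula := Formula.neg (Formula.ex 0 (Formula.atom 15 [Term.var 0]))

theorem mem_ans_notHalted {I : Instance} {σ : ℕ → ℕ} :
    σ ∈ notHalted.ans I ↔ ∀ y, haltAtom y ∉ I := by
  have hfv : notHalted.fv = ∅ := by decide
  have hh : ∀ D v, Formula.Holds D I v notHalted ↔ ¬ ∃ d ∈ D, haltAtom d ∈ I := fun D v => by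
    simp [notHalted, Formula.Holds, Term.eval]
  simp only [Formula.ans, Formula.ansOver, Set.mem_ofPred_eq, hfv, Finset.notMem_empty,
    false_imp_iff, implies_true, true_and, hh, not_exists, not_and]
  -- A result `y` belongs to the active domain by its very occurrence in the halt fact, so bounding
  -- the quantifier loses nothing.
  refine forall_congr' fun y => ⟨fun h hy => h (Or.inl ⟨_, hy, ?_⟩) hy, fun h _ => h⟩
  exact List.mem_singleton_self y

def evalRule : Rule := ⟨notHalted, 0⟩

/-- The system that evaluates the code `u` at `n`, one round of the rules at a time. -/
def evalDCDS (u : Code) (n : ℕ) : DCDS where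
  data :=
    { schema := evalSchema
      constraints := []
      init := evalInit u n
      init_conforms := conforms_evalInit u n
      constraints_wf := by simp
      init_sat := by simp }
  process :=
    { services := [1]
      actions := [hornAction evalRules]
      rules := [evalRule]
      actions_wf := by
        simp only [List.mem_singleton, forall_eq]
        refine ⟨List.nodup_nil, fun e he => ?_⟩
        simp only [hornAction, List.mem_append, List.mem_map, List.mem_singleton] at he
        rcases he with ⟨r, hr, rfl⟩ | rfl
        · exact HornRule.effect_wellFormed (evalRules_wellFormed r hr)
        · exact growEffect_wellFormed rfl rfl
      rules_wf := by
        simp only [List.mem_singleton, forall_eq]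
        refine ⟨rfl, ?_, _, rfl, by decide⟩
        have : evalRule.guard.consts = ∅ := by decide
        simp [this] }

variable {u : Code} {n : ℕ}

theorem step_evalDCDS {s s' : ConcreteState} :
    (evalDCDS u n).Step s s' ↔ (∀ y, haltAtom y ∉ s.inst) ∧
      s.calls.IsExtension s'.calls {t | ∃ x, (1, [x]) ∈ s.inst ∧ t = (0, [x])} ∧
      s'.inst = nextInst evalRules (fun x => (s'.calls (0, [x])).getD 0) s.inst := by
  have key : ∀ σ, (evalDCDS u n).Exec notHalted (hornAction evalRules) σ s s' ↔
      (∀ y, haltAtom y ∉ s.inst) ∧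
      s.calls.IsExtension s'.calls {t | ∃ x, (1, [x]) ∈ s.inst ∧ t = (0, [x])} ∧
      s'.inst = nextInst evalRules (fun x => (s'.calls (0, [x])).getD 0) s.inst := fun σ => by
    have hc : ∀ e ∈ (evalDCDS u n).data.constraints, e.Sat s'.inst := by simp [evalDCDS]
    rw [DCDS.Exec, mem_ans_notHalted, callsIn_doAction]
    refine and_congr_right fun _ => and_congr_right fun hM => ?_
    -- The default `0` has no effect: after the step every call on a marked element has a value.
    rw [apply_doAction (g := fun x => (s'.calls (0, [x])).getD 0), and_iff_left hc]
    intro x hx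
    obtain ⟨c, hc⟩ := Option.isSome_iff_exists.1 ((hM.2 (0, [x])).2 (Or.inr ⟨x, hx, rfl⟩))
    simp [hc]
  constructor
  · rintro ⟨r, hr, α, hα, σ, h⟩
    obtain rfl := List.mem_singleton.1 hr
    obtain rfl := Option.some.inj hα
    exact (key σ).1 h
  · exact fun h => ⟨evalRule, List.mem_singleton_self _, _, rfl, fun _ => 0, (key _).2 h⟩

/-! #### Halting computations give bounded systems -/

/-- In any run, a stage is the image of the corresponding stage of the evaluation, up to further
facts. -/
theorem exists_hom_evalStage (τ : (evalDCDS u n).concreteTS.Run) :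
    ∃ e : ℕ → ℕ, ∀ k : ℕ, (k : ℕ∞) ≤ τ.last →
      (∀ F ∈ evalStage u n k, instAtom e F ∈ (τ.state k).1.inst) ∧
      adom (τ.state k).1.inst ⊆ e '' Set.Iic (n + encode u + k) := by
  have hinit : (τ.state 0).1.inst = {F | F ∈ evalInit u n} := by rw [τ.state_zero]; rfl
  have hstep : ∀ k : ℕ, ((k + 1 : ℕ) : ℕ∞) ≤ τ.last → (k : ℕ∞) ≤ τ.last ∧
      ∃ g, (τ.state (k + 1)).1.inst = nextInst evalRules g (τ.state k).1.inst := fun k hk =>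
    ⟨le_trans (by exact_mod_cast k.le_succ) hk, _, (step_evalDCDS.1 (τ.step k hk)).2.2⟩
  -- Along the run, too, each state has a unique marked element, whatever the service returns. Past
  -- the end of the run the witness is arbitrary.
  have htop : ∀ k : ℕ, ∃ x, (k : ℕ∞) ≤ τ.last → ∀ y, (1, [y]) ∈ (τ.state k).1.inst ↔ y = x := by
    intro k
    induction k with
    | zero => exact ⟨n + encode u, fun _ y => by rw [hinit]; exact top_mem_evalInit⟩
    | succ k ih =>
      obtain ⟨x, hx⟩ := ih
      by_cases hk : ((k + 1 : ℕ) : ℕ∞) ≤ τ.last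
      · obtain ⟨hk', g, hg⟩ := hstep k hk
        exact ⟨g x, fun _ y => by rw [hg, top_mem_nextInst]; simp [hx hk']⟩
      · exact ⟨0, fun h => absurd h hk⟩
  choose x hx using htop
  set m := n + encode u with hm
  -- The homomorphism fixes the initial constants and sends the `k`-th new number of the ideal run
  -- to the element marked in the `k`-th state. It need not be injective, as the service may repeat
  -- values.
  let e : ℕ → ℕ := fun j => if j ≤ m then j else x (j - m)
  have hx0 : x 0 = m := by
    have := (hx 0 (by simp) m).1
    rw [hinit] at this
    exact (this (top_mem_evalInit.2 rfl)).symm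
  have he : ∀ k, e (m + k) = x k := fun k => by
    rcases k with _ | k
    · simp [e, hx0]
    · simp [e]
  refine ⟨e, fun k => ?_⟩
  induction k with
  | zero =>
    intro _
    rw [hinit]
    have hle := le_of_mem_evalInit (u := u) (n := n)
    constructor
    · intro F hF
      have : F.2.map e = F.2 :=
        (List.map_congr_left fun y hy => if_pos (hle F hF y hy)).trans (List.map_id _)
      rw [instAtom, this]
      exact hF
    · rintro c ⟨F, hF, hc⟩
      exact ⟨c, hle F hF c hc, if_pos (hle F hF c hc)⟩
  | succ k ih =>
    intro hk
    obtain ⟨hk', g, hg⟩ := hstep k hk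
    obtain ⟨h1, h2⟩ := ih hk'
    have hgx : g (x k) = x (k + 1) := by
      rw [← hx (k + 1) hk, hg, top_mem_nextInst]
      exact ⟨_, (hx k hk' _).2 rfl, rfl⟩
    rw [hg]
    constructor
    · refine instAtom_mem_nextInst h1 fun y hy => ?_
      rw [top_mem_evalStage.1 hy, he, hgx, ← he (k + 1)]
      rfl
    · refine (adom_nextInst evalRules_wellFormed).trans (Set.union_subset ?_ ?_)
      · exact h2.trans (Set.image_mono (Set.Iic_subset_Iic.2 (by omega)))
      · rintro _ ⟨y, hy, rfl⟩
        rw [(hx k hk' y).1 hy, hgx, ← he (k + 1)]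
        exact ⟨_, Set.mem_Iic.2 le_rfl, rfl⟩

theorem runBounded_of_dom (h : (u.eval n).Dom) : (evalDCDS u n).RunBounded := by
  obtain ⟨T, y, hT⟩ := eventually_halt h
  -- The values lie in the image of a segment with `n + encode u + T + 1` elements; strictness costs
  -- one more.
  refine ⟨n + encode u + T + 2, fun τ => ?_⟩
  obtain ⟨e, he⟩ := exists_hom_evalStage τ
  have hlast : ∀ k : ℕ, (k : ℕ∞) ≤ τ.last → k ≤ T := fun k hk => by
    by_contra! hlt
    have hk1 : ((T + 1 : ℕ) : ℕ∞) ≤ τ.last := le_trans (by exact_mod_cast hlt) hk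
    have hk0 : (T : ℕ∞) ≤ τ.last := le_trans (by exact_mod_cast T.le_succ) hk1
    -- The image of the ideal halt fact is in state `T` and falsifies the guard of the next step.
    exact (step_evalDCDS.1 (τ.step T hk1)).1 (e y) ((he T hk0).1 _ hT)
  have hsub : τ.values ⊆ e '' Set.Iic (n + encode u + T) := by
    rintro c ⟨k, hk, hc⟩
    refine Set.image_mono (Set.Iic_subset_Iic.2 ?_) ((he k hk).2 hc)
    have := hlast k hk
    omega
  calc τ.values.encard ≤ (e '' Set.Iic (n + encode u + T)).encard := Set.encard_le_encard hsub
    _ ≤ (Set.Iic (n + encode u + T)).encard := Set.encard_image_le _ _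
    _ = ((n + encode u + T + 1 : ℕ) : ℕ∞) := by
      rw [← Finset.coe_Iic, Set.encard_coe_eq_coe_finsetCard, Nat.card_Iic]
    _ < ((n + encode u + T + 2 : ℕ) : ℕ∞) := by exact_mod_cast Nat.lt_succ_self _

/-! #### Computations that do not halt give unbounded systems -/

open Classical in
/-- The state after `k` steps if the service always returns the successor. -/
noncomputable def succState (u : Code) (n k : ℕ) : ConcreteState where
  inst := evalStage u n k
  -- The first `k` steps call the service on the marked elements of stages `0` to `k - 1`.
  calls t := if ∃ x, n + encode u ≤ x ∧ x < n + encode u + k ∧ t = (0, [x])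
    then some (t.2.headD 0 + 1) else none

theorem succState_zero : succState u n 0 = (evalDCDS u n).initState := by
  simp only [succState, DCDS.initState, ConcreteState.mk.injEq]
  refine ⟨rfl, funext fun t => if_neg ?_⟩
  rintro ⟨x, h1, h2, -⟩
  omega

/-- The guard stays true by soundness: a halt fact in a stage would mean that `u` halts at `n`. -/
theorem step_succState (h : ¬ (u.eval n).Dom) (k : ℕ) :
    (evalDCDS u n).Step (succState u n k) (succState u n (k + 1)) := by
  refine step_evalDCDS.2 ⟨fun y hy => h (trueFact_evalStage _ hy), ⟨fun t c ht => ?_, fun t => ?_⟩,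
    ?_⟩
  · simp only [succState, Option.ite_none_right_eq_some] at ht ⊢
    obtain ⟨⟨x, h1, h2, rfl⟩, hc⟩ := ht
    exact ⟨⟨x, h1, by omega, rfl⟩, hc⟩
  · have hs : ∀ j t, ((succState u n j).calls t).isSome ↔
        ∃ x, n + encode u ≤ x ∧ x < n + encode u + j ∧ t = (0, [x]) := fun j t => by
      simp only [succState]
      split_ifs with h <;> simpa using h
    simp only [hs]
    simp only [succState, top_mem_evalStage, Set.mem_ofPred_eq, exists_eq_left]
    constructor
    · rintro ⟨x, h1, h2, rfl⟩
      rcases Nat.lt_or_ge x (n + encode u + k) with h | h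
      · exact Or.inl ⟨x, h1, h, rfl⟩
      · exact Or.inr (by rw [show x = n + encode u + k by omega])
    · rintro (⟨x, h1, h2, rfl⟩ | rfl)
      · exact ⟨x, h1, by omega, rfl⟩
      · exact ⟨_, by omega, by omega, rfl⟩
  · ext F
    have hg : ∀ x, (1, [x]) ∈ evalStage u n k →
        ((succState u n (k + 1)).calls (0, [x])).getD 0 = Nat.succ x := fun x hx => by
      have hx := top_mem_evalStage.1 hx
      simp only [succState]
      rw [if_pos ⟨x, by omega, by omega, rfl⟩]
      rfl
    refine or_congr Iff.rfl (exists_congr fun x => and_congr_right fun hx => ?_)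
    simp only [hg x hx]

theorem isState_succState (h : ¬ (u.eval n).Dom) (k : ℕ) :
    (evalDCDS u n).IsState (succState u n k) := by
  induction k with
  | zero =>
    rw [succState_zero]
    exact DCDS.IsState.init
  | succ k ih => exact ih.step (step_succState h k)

/-- In the ideal run every number from `n + encode u` on is marked at some stage. -/
theorem not_runBounded_of_not_dom (h : ¬ (u.eval n).Dom) : ¬ (evalDCDS u n).RunBounded := by
  rintro ⟨b, hb⟩
  let τ : (evalDCDS u n).concreteTS.Run :=
    { last := ⊤
      state := fun k => ⟨succState u n k, isState_succState h k⟩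
      state_zero := Subtype.ext succState_zero
      step := fun k _ => step_succState h k }
  have hsub : Set.Ici (n + encode u) ⊆ τ.values := fun x hx => by
    obtain ⟨k, rfl⟩ := Nat.exists_eq_add_of_le (Set.mem_Ici.1 hx)
    exact ⟨k, le_top, _, top_mem_evalStage.2 rfl, List.mem_singleton_self _⟩
  have hinf := ((Set.Ici_infinite (n + encode u)).mono hsub).encard_eq
  have := hb τ
  rw [hinf] at this
  exact not_top_lt this

/-! #### Computability -/

theorem encode_dcds (S : DCDS) : encode S = encode S.description := rfl

/-- Everything but the initial facts is fixed and contributes a constant to the number of the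
system, so nothing about the numbering of formulas has to be computed. -/
theorem computable_encode_description (schema : List ℕ) (constraints : List EqConstraint)
    (process : List ℕ × List Action × List Rule) {f : ℕ → List Fact} (hf : Primrec f) :
    Computable fun n => encode ((schema, constraints, f n), process) := by
  change Computable fun n => Nat.pair (Nat.pair (encode schema)
    (Nat.pair (encode constraints) (encode (f n)))) (encode process)
  exact (Primrec₂.natPair.comp (Primrec₂.natPair.comp (.const _) (Primrec₂.natPair.comp (.const _)
    (Primrec.encode.comp hf))) (.const _)).to_comp

theorem computable_encode_evalDCDS (u : Code) : Computable fun n => encode (evalDCDS u n) := by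
  have hinit : Primrec (evalInit u) := by
    have hm : Primrec fun n : ℕ => n + encode u := Primrec.nat_add.comp .id (.const _)
    have hR : ∀ R : ℕ, Primrec fun x : ℕ => ((R, [x]) : Fact) := fun R =>
      (Primrec.const R).pair (Primrec.list_cons.comp .id (.const []))
    have hR2 : ∀ R : ℕ, Primrec₂ fun x y : ℕ => ((R, [x, y]) : Fact) := fun R =>
      (Primrec.const R).pair (Primrec.list_cons.comp .fst
        (Primrec.list_cons.comp .snd (.const [])))
    refine Primrec.list_append.comp (Primrec.list_map (Primrec.list_range.comp hm)
      ((hR2 0).comp .snd (Primrec.succ.comp .snd)).to₂) ?_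
    exact Primrec.list_cons.comp ((hR 1).comp hm) (Primrec.list_cons.comp (.const _)
      (Primrec.list_cons.comp ((hR2 14).comp (.const _) .id) (.const _)))
  refine (computable_encode_description evalSchema [] ([1], [hornAction evalRules], [evalRule])
    hinit).of_eq fun n => ?_
  rw [encode_dcds]
  rfl

end DataCentric

/-! ### Reduction from the halting problem -/

theorem mainTheorem9 : ¬ AlgorithmicallyDecidable DCDS.RunBounded := by
  rintro ⟨p, hp, h⟩
  -- A universal function: its code `u` is chosen once, and the program `c` whose halting at `0` is
  -- asked enters only as the input `encode c`.
  have hpart : Nat.Partrec fun n => (Denumerable.ofNat Nat.Partrec.Code n).eval 0 :=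
    Partrec.nat_iff.1 (Nat.Partrec.Code.eval_part.comp (Computable.ofNat _) (Computable.const 0))
  obtain ⟨u, hu⟩ := Nat.Partrec.Code.exists_code.1 hpart
  obtain ⟨_, hp⟩ := hp
  have hred : ComputablePred fun c : Nat.Partrec.Code =>
      p (Encodable.encode (DataCentric.evalDCDS u (Encodable.encode c))) :=
    ⟨fun _ => inferInstance,
      hp.comp ((DataCentric.computable_encode_evalDCDS u).comp Computable.encode)⟩
  refine ComputablePred.halting_problem 0 (hred.of_eq fun c => ?_)
  have hc : u.eval (Encodable.encode c) = c.eval 0 := by simp [hu]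
  rw [h, ← hc]
  exact ⟨not_imp_not.1 DataCentric.not_runBounded_of_not_dom, DataCentric.runBounded_of_dom⟩
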